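/- Let $M,N\ge 2$ be integers and $0<p_0<1$. On $[0,1)$ consider the maps $f_0(x)=Nx \pmod 1$ and $f_i(x)=(x+i-1)/M$ for $1\le i\le M$. Let $\Sigma=\{0,1,\dots,M\}^{\mathbb N}$ with left shift $\sigma$, let $\nu$ be the Bernoulli (product) measure on $\Sigma$ with probability vector $\left(p_0,\frac{1-p_0}{M},\dots,\frac{1-p_0}{M}\right)$, let $\lambda$ be Lebesgue measure on $[0,1)$, and let $F:\Sigma\times[0,1)\to\Sigma\times[0,1)$, $F(\omega,x)=(\sigma\omega,f_{\omega_0}(x))$. Write $f^n_\omega=f_{\omega_{n-1}}\circ\cdots\circ f_{\omega_0}$ (with $f^0_\omega$ the identity) and let $L_{p_0}=p_0\ln N-(1-p_0)\ln M$ be the Lyapunov exponent. In each of the three cases $L_{p_0}<0$, $L_{p_0}=0$ and $L_{p_0}>0$, the product measure $\nu\times\lambda$ is an ergodic invariant measure for $F$. Consequently, typical orbits are uniformly distributed: for every Borel set $A\subseteq[0,1)$ and for $(\nu\times\lambda)$-almost all $(\omega,x)\in\Sigma\times[0,1)$, \[ \lim_{n\to\infty}\frac1n\sum_{i=0}^{n-1}\chi_A\bigl(f^i_\omega(x)\bigr)=\lambda(A),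 \] where $\chi_A$ is the characteristic function of $A$. -/

import Mathlib

open MeasureTheory Filter Topology

/-- The half-open unit interval `[0,1)`, with its Borel `σ`-algebra. -/
abbrev UnitIco : Type := Set.Ico (0 : ℝ) 1

/-- Lebesgue measure `λ` on `[0,1)`. -/
noncomputable def lebesgueIco : Measure UnitIco :=
  Measure.comap (Subtype.val : UnitIco → ℝ) volume

/-- The maps `f_0, …, f_M` of `[0,1)`: `f_0 x = N x (mod 1)` and `f_i x = (x + i - 1) / M`
for `1 ≤ i ≤ M`. -/
noncomputable def fiberMap (M N : ℕ) (i : Fin (M + 1)) (x : UnitIco) : UnitIco :=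
  if h : i = 0 then
    ⟨Int.fract ((N : ℝ) * x), Int.fract_nonneg _, Int.fract_lt_one _⟩
  else
    ⟨((x : ℝ) + ((i : ℕ) : ℝ) - 1) / (M : ℝ), by
      have hi : 1 ≤ (i : ℕ) := by
        rcases Nat.eq_zero_or_pos (i : ℕ) with h0 | h0
        · exact absurd (Fin.ext h0) h
        · exact h0
      have hiM : (i : ℕ) ≤ M := Nat.lt_succ_iff.mp i.2
      have h1 : (1 : ℝ) ≤ ((i : ℕ) : ℝ) := by exact_mod_cast hi
      have h2 : ((i : ℕ) : ℝ) ≤ (M : ℝ) := by exact_mod_cast hiM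
      have hM : (0 : ℝ) < (M : ℝ) := by linarith
      have hx0 : (0 : ℝ) ≤ (x : ℝ) := x.2.1
      have hx1 : (x : ℝ) < 1 := x.2.2
      refine ⟨div_nonneg (by linarith) hM.le, ?_⟩
      rw [div_lt_one hM]
      linarith⟩

/-- The random compositions `f_ω^n = f_{ω_{n-1}} ∘ ⋯ ∘ f_{ω_0}`. -/
noncomputable def randomOrbit (M N : ℕ) (ω : ℕ → Fin (M + 1)) : ℕ → UnitIco → UnitIco
  | 0, x => x
  | n + 1, x => fiberMap M N (ω n) (randomOrbit M N ω n x)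

/-- The skew product `F (ω, x) = (σ ω, f_{ω_0} x)` over the left shift `σ`. -/
noncomputable def skewProduct (M N : ℕ) (z : (ℕ → Fin (M + 1)) × UnitIco) :
    (ℕ → Fin (M + 1)) × UnitIco :=
  (fun n => z.1 (n + 1), fiberMap M N (z.1 0) z.2)

/-- The probability vector `(p₀, (1 - p₀)/M, …, (1 - p₀)/M)`. -/
noncomputable def probVec (M : ℕ) (p₀ : ℝ) (i : Fin (M + 1)) : ℝ :=
  if i = 0 then p₀ else (1 - p₀) / M

theorem probVec_nonneg (M : ℕ) (p₀ : ℝ) (h₀ : 0 < p₀) (h₁ : p₀ < 1) (i : Fin (M + 1)) :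
    0 ≤ probVec M p₀ i := by
  unfold probVec
  split_ifs
  · exact h₀.le
  · exact div_nonneg (by linarith) (Nat.cast_nonneg M)

theorem sum_probVec (M : ℕ) (hM : 2 ≤ M) (p₀ : ℝ) : ∑ i, probVec M p₀ i = 1 := by
  have hM' : (M : ℝ) ≠ 0 := by
    have : M ≠ 0 := by omega
    exact_mod_cast this
  rw [Fin.sum_univ_succ]
  simp only [probVec, if_true, Fin.succ_ne_zero, if_false, Finset.sum_const, Finset.card_univ,
    Fintype.card_fin, nsmul_eq_mul]
  field_simp
  ring

/-- The distribution of a single symbol. -/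
noncomputable def symbolPMF (M : ℕ) (hM : 2 ≤ M) (p₀ : ℝ) (h₀ : 0 < p₀) (h₁ : p₀ < 1) :
    PMF (Fin (M + 1)) :=
  PMF.ofFintype (fun i => ENNReal.ofReal (probVec M p₀ i)) (by
    rw [← ENNReal.ofReal_sum_of_nonneg (fun i _ => probVec_nonneg M p₀ h₀ h₁ i),
      sum_probVec M hM p₀, ENNReal.ofReal_one])

/-- The Bernoulli measure `ν` on `{0, …, M}^ℕ`. -/
noncomputable def bernoulliSeq (M : ℕ) (hM : 2 ≤ M) (p₀ : ℝ) (h₀ : 0 < p₀) (h₁ : p₀ < 1) :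
    Measure (ℕ → Fin (M + 1)) :=
  Measure.infinitePi (fun _ : ℕ => (symbolPMF M hM p₀ h₀ h₁).toMeasure)

/-- The product measure `μ = ν × λ` on `{0, …, M}^ℕ × [0,1)`. -/
noncomputable def skewMeasure (M : ℕ) (hM : 2 ≤ M) (p₀ : ℝ) (h₀ : 0 < p₀) (h₁ : p₀ < 1) :
    Measure ((ℕ → Fin (M + 1)) × UnitIco) :=
  (bernoulliSeq M hM p₀ h₀ h₁).prod lebesgueIco

/-- The Lyapunov exponent `L_{p₀} = p₀ ln N - (1 - p₀) ln M`. -/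
noncomputable def lyapunovExp (M N : ℕ) (p₀ : ℝ) : ℝ :=
  p₀ * Real.log N - (1 - p₀) * Real.log M

/-- Typical orbits are uniformly distributed: every Borel set `A ⊆ [0,1)` is visited by
`μ`-almost every orbit with asymptotic frequency `λ(A)`. -/
def TypicalOrbitsUniform (M N : ℕ) (hM : 2 ≤ M) (p₀ : ℝ) (h₀ : 0 < p₀) (h₁ : p₀ < 1) : Prop :=
  ∀ A : Set UnitIco, MeasurableSet A →
    ∀ᵐ z ∂(skewMeasure M hM p₀ h₀ h₁),
      Tendsto (fun n : ℕ => (1 / (n : ℝ)) *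
          ∑ i ∈ Finset.range n, A.indicator (fun _ => (1 : ℝ)) (randomOrbit M N z.1 i z.2))
        atTop (𝓝 ((lebesgueIco A).toReal))

/-!
The sign of the Lyapunov exponent plays no role: the skew product is ergodic because one of the
fibre maps, `f₀ x = N x (mod 1)`, already is.

Lebesgue measure is stationary, `∑ p_i (f_i)_* λ = λ`, since `f₀` preserves it and the contractions
`f_1, …, f_M`, taken with equal weights, map `[0,1)` onto the `M` intervals `[j/M, (j+1)/M)` of a
partition of `[0,1)` (`stationary_lebesgueIco`). Hence `ν × λ` is invariant. If `A` is an invariant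
set of the skew product, then `h x = ν {ω | (ω, x) ∈ A}` satisfies `∑ p_i h ∘ f_i = h`, and
stationarity gives `∑ p_i ∫ (h ∘ f_i - h)² dλ = 0`, so `h ∘ f_i = h` almost everywhere for all `i`
(`ae_comp_eq_of_harmonic`). As `f₀` is conjugate to multiplication by `N` on the circle, it is
ergodic and `h` is almost everywhere a constant `c`. Conditioning on the first symbols and using the
invariance of `A` shows that `A` is independent of every cylinder times a Borel set, hence of every
measurable set and of itself, so that its measure is `0` or `1` (`ergodic_shiftSkew`).

Equidistribution is the pointwise ergodic theorem (`Ergodic.ae_tendsto_birkhoffAverage`) for the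
indicator function of `{(ω, x) | x ∈ A}`. For an ergodic map that theorem reduces to the statement
that Birkhoff sums of a function with negative integral are almost everywhere bounded above
(`Ergodic.ae_bddAbove_birkhoffSum`).
-/

/-! ### The pointwise ergodic theorem for ergodic maps -/

section Birkhoff

variable {α : Type*}

/-- The running maximum `max_{0 ≤ k ≤ n} S_k g` of the Birkhoff sums of `g`, with `S_0 g = 0`,
given by the recursion `M_{n+1} = max 0 (g + M_n ∘ T)`. -/
noncomputable def birkhoffMax (T : α → α) (g : α → ℝ) : ℕ → α → ℝ
  | 0, _ => 0
  | n + 1, x => max 0 (g x + birkhoffMax T g n (T x))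

theorem birkhoffMax_nonneg (T : α → α) (g : α → ℝ) (n : ℕ) (x : α) :
    0 ≤ birkhoffMax T g n x := by
  cases n with
  | zero => exact le_rfl
  | succ n => exact le_max_left _ _

theorem birkhoffMax_le_succ (T : α → α) (g : α → ℝ) (n : ℕ) (x : α) :
    birkhoffMax T g n x ≤ birkhoffMax T g (n + 1) x := by
  induction n generalizing x with
  | zero => exact birkhoffMax_nonneg T g 1 x
  | succ n ih => exact max_le_max le_rfl (by linarith [ih (T x)])

theorem birkhoffSum_le_birkhoffMax (T : α → α) (g : α → ℝ) (n : ℕ) (x : α) :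
    birkhoffSum T g n x ≤ birkhoffMax T g n x := by
  induction n generalizing x with
  | zero => simp [birkhoffMax]
  | succ n ih =>
    rw [birkhoffSum_succ']
    exact le_max_of_le_right (by linarith [ih (T x)])

theorem birkhoffMax_succ_sub (T : α → α) (g : α → ℝ) (n : ℕ) (x : α) :
    birkhoffMax T g (n + 1) x - birkhoffMax T g n (T x) =
      max (-birkhoffMax T g n (T x)) (g x) := by
  rw [birkhoffMax, ← max_sub_sub_right]
  ring_nf

variable [MeasurableSpace α] {μ : Measure α} {T : α → α} {g : α → ℝ}

theorem measurable_birkhoffMax (hT : Measurable T) (hg : Measurable g) (n : ℕ) :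
    Measurable (birkhoffMax T g n) := by
  induction n with
  | zero => exact measurable_const
  | succ n ih => exact measurable_const.max (hg.add (ih.comp hT))

theorem integrable_birkhoffMax [IsFiniteMeasure μ] (hT : MeasurePreserving T μ μ)
    (hg : Integrable g μ) (n : ℕ) : Integrable (birkhoffMax T g n) μ := by
  induction n with
  | zero => exact integrable_const 0
  | succ n ih =>
    exact (integrable_const 0).sup (hg.add (hT.integrable_comp_of_integrable ih))

/-- If `∫ g < 0`, then the Birkhoff sums of `g` are almost everywhere bounded above. The set where
they are not is invariant; were it of full measure, `M_{n+1} - M_n ∘ T = max (-M_n ∘ T) g` would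
decrease to `g`, although its integral is `∫ (M_{n+1} - M_n) ≥ 0`. -/
theorem Ergodic.ae_bddAbove_birkhoffSum [IsProbabilityMeasure μ] (hT : Ergodic T μ)
    (hgm : Measurable g) (hg : Integrable g μ) (hneg : ∫ x, g x ∂μ < 0) :
    ∀ᵐ x ∂μ, ∃ C : ℕ, ∀ n, birkhoffSum T g n x ≤ C := by
  set A : Set α := {x | ∀ C : ℕ, ∃ n, (C : ℝ) < birkhoffMax T g n x} with hA
  have hAm : MeasurableSet A := by
    have : A = ⋂ C : ℕ, ⋃ n, {x | (C : ℝ) < birkhoffMax T g n x} := by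
      ext x; simp [hA]
    rw [this]
    exact .iInter fun C => .iUnion fun n =>
      measurableSet_lt measurable_const (measurable_birkhoffMax hT.measurable hgm n)
  have hAinv : T ⁻¹' A = A := by
    ext x
    simp only [hA, Set.mem_preimage, Set.mem_ofPred_eq]
    constructor
    · intro h C
      obtain ⟨K, hK⟩ := exists_nat_ge ((C : ℝ) - g x)
      obtain ⟨n, hn⟩ := h K
      exact ⟨n + 1, lt_max_of_lt_right (by linarith)⟩
    · intro h C
      obtain ⟨K, hK⟩ := exists_nat_ge ((C : ℝ) + g x)
      obtain ⟨n, hn⟩ := h K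
      cases n with
      | zero => exact absurd hn (not_lt.2 (Nat.cast_nonneg K))
      | succ n =>
        refine ⟨n, ?_⟩
        rcases lt_max_iff.1 hn with h0 | h1
        · exact absurd h0 (not_lt.2 (Nat.cast_nonneg K))
        · linarith
  rcases hT.ae_mem_or_ae_notMem hAm hAinv with hfull | hnull
  · exfalso
    have hlim : Tendsto (fun n => ∫ x, (birkhoffMax T g (n + 1) x - birkhoffMax T g n (T x)) ∂μ)
        atTop (𝓝 (∫ x, g x ∂μ)) := by
      refine tendsto_integral_of_dominated_convergence (fun x => |g x|) (fun n => ?_) hg.abs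
        (fun n => Eventually.of_forall fun x => ?_) ?_
      · exact ((measurable_birkhoffMax hT.measurable hgm _).sub
          ((measurable_birkhoffMax hT.measurable hgm _).comp hT.measurable)).aestronglyMeasurable
      · rw [birkhoffMax_succ_sub, Real.norm_eq_abs, abs_le]
        exact ⟨(neg_abs_le _).trans (le_max_right _ _),
          max_le ((neg_nonpos.2 (birkhoffMax_nonneg T g n _)).trans (abs_nonneg _)) (le_abs_self _)⟩
      · filter_upwards [hfull] with x hx
        have hTx : T x ∈ A := by rwa [← Set.mem_preimage, hAinv]
        obtain ⟨K, hK⟩ := exists_nat_ge (-g x)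
        obtain ⟨n₀, hn₀⟩ := hTx K
        refine tendsto_const_nhds.congr' ?_
        filter_upwards [eventually_ge_atTop n₀] with n hn
        have := monotone_nat_of_le_succ (fun n => birkhoffMax_le_succ T g n (T x)) hn
        rw [birkhoffMax_succ_sub, max_eq_right (by linarith)]
    have hnonneg : ∀ n, 0 ≤ ∫ x, (birkhoffMax T g (n + 1) x - birkhoffMax T g n (T x)) ∂μ := by
      intro n
      have hi := integrable_birkhoffMax hT.toMeasurePreserving hg
      have hiT : Integrable (fun x => birkhoffMax T g n (T x)) μ :=
        hT.toMeasurePreserving.integrable_comp_of_integrable (hi n)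
      rw [integral_sub (hi _) hiT]
      have hcomp : ∫ x, birkhoffMax T g n (T x) ∂μ = ∫ x, birkhoffMax T g n x ∂μ := by
        conv_rhs => rw [← hT.toMeasurePreserving.map_eq]
        exact (integral_map hT.measurable.aemeasurable
          (measurable_birkhoffMax hT.measurable hgm n).aestronglyMeasurable).symm
      rw [hcomp, sub_nonneg]
      exact integral_mono (hi _) (hi _) (birkhoffMax_le_succ T g n)
    exact absurd (ge_of_tendsto' hlim hnonneg) (not_le.2 hneg)
  · filter_upwards [hnull] with x hx
    simp only [hA, Set.mem_ofPred_eq, not_forall, not_exists, not_lt] at hx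
    obtain ⟨C, hC⟩ := hx
    exact ⟨C, fun n => (birkhoffSum_le_birkhoffMax T g n x).trans (hC n)⟩

theorem Ergodic.ae_eventually_birkhoffAverage_lt [IsProbabilityMeasure μ] (hT : Ergodic T μ)
    (hgm : Measurable g) (hg : Integrable g μ) {a : ℝ} (ha : ∫ x, g x ∂μ < a) :
    ∀ᵐ x ∂μ, ∀ᶠ n in atTop, birkhoffAverage ℝ T g n x < a := by
  obtain ⟨b, hgb, hba⟩ := exists_between ha
  have hint : ∫ x, (g x - b) ∂μ < 0 := by
    rw [integral_sub hg (integrable_const b)]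
    simpa using hgb
  filter_upwards [hT.ae_bddAbove_birkhoffSum (hgm.sub_const b) (hg.sub (integrable_const b)) hint]
    with x ⟨C, hC⟩
  obtain ⟨K, hK⟩ := exists_nat_gt ((C : ℝ) / (a - b))
  filter_upwards [eventually_ge_atTop (max K 1)] with n hn
  have hn1 : (0 : ℝ) < n := by exact_mod_cast lt_of_lt_of_le one_pos ((le_max_right _ _).trans hn)
  have hKn : (K : ℝ) ≤ n := by exact_mod_cast (le_max_left _ _).trans hn
  have h1 : birkhoffSum T g n x - n * b ≤ C := by
    have := hC n
    simpa [birkhoffSum, Finset.sum_sub_distrib] using this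
  have h2 : (C : ℝ) < n * (a - b) := by
    rw [div_lt_iff₀ (by linarith)] at hK
    nlinarith
  rw [birkhoffAverage, smul_eq_mul, inv_mul_lt_iff₀ hn1]
  linarith

/-- The **pointwise ergodic theorem** for ergodic maps. -/
theorem Ergodic.ae_tendsto_birkhoffAverage [IsProbabilityMeasure μ] (hT : Ergodic T μ)
    (hgm : Measurable g) (hg : Integrable g μ) :
    ∀ᵐ x ∂μ, Tendsto (fun n => birkhoffAverage ℝ T g n x) atTop (𝓝 (∫ x, g x ∂μ)) := by
  have hpos : ∀ k : ℕ, (0 : ℝ) < 1 / (k + 1) := fun k => Nat.one_div_pos_of_nat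
  have hup : ∀ᵐ x ∂μ, ∀ k : ℕ, ∀ᶠ n in atTop,
      birkhoffAverage ℝ T g n x < ∫ x, g x ∂μ + 1 / (k + 1) :=
    ae_all_iff.2 fun k => hT.ae_eventually_birkhoffAverage_lt hgm hg (by linarith [hpos k])
  have hlow : ∀ᵐ x ∂μ, ∀ k : ℕ, ∀ᶠ n in atTop,
      birkhoffAverage ℝ T (-g) n x < -∫ x, g x ∂μ + 1 / (k + 1) := by
    refine ae_all_iff.2 fun k => hT.ae_eventually_birkhoffAverage_lt hgm.neg hg.neg ?_
    have : ∫ x, (-g) x ∂μ = -∫ x, g x ∂μ := integral_neg g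
    linarith [hpos k]
  filter_upwards [hup, hlow] with x hx hx'
  rw [Metric.tendsto_atTop']
  intro ε hε
  obtain ⟨k, hk⟩ := exists_nat_one_div_lt hε
  obtain ⟨n₀, hn₀⟩ := ((hx k).and (hx' k)).exists_forall_of_atTop
  refine ⟨n₀, fun n hn => ?_⟩
  obtain ⟨h1, h2⟩ := hn₀ n hn.le
  rw [birkhoffAverage_neg, Pi.neg_apply, Pi.neg_apply] at h2
  rw [Real.dist_eq, abs_lt]
  constructor <;> linarith

end Birkhoff

/-! ### Skew products over a Bernoulli shift -/

section RandomMaps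

variable {ι X : Type*}

/-- The sequence `i, ω 0, ω 1, …`. -/
def consSeq (i : ι) (ω : ℕ → ι) : ℕ → ι
  | 0 => i
  | n + 1 => ω n

theorem consSeq_preimage_pi_range (n : ℕ) (t : ℕ → Set ι) (i : ι) (hi : i ∈ t 0) :
    consSeq i ⁻¹' (Set.pi (Finset.range (n + 1)) t) =
      Set.pi (Finset.range n) fun k => t (k + 1) := by
  ext ω
  simp only [Set.mem_preimage, Set.mem_pi, Finset.coe_range, Set.mem_Iio]
  constructor
  · intro h k hk
    exact h (k + 1) (by omega)
  · rintro h (_ | k) hk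
    · exact hi
    · exact h k (by omega)

/-- A box over a finite set of coordinates is a box over an initial segment of coordinates, which
allows induction on the number of symbols. -/
theorem exists_pi_range_eq [MeasurableSpace ι] (s : Finset ℕ) (t : ℕ → Set ι)
    (ht : ∀ k, MeasurableSet (t k)) :
    ∃ (n : ℕ) (t' : ℕ → Set ι), (∀ k, MeasurableSet (t' k)) ∧
      Set.pi s t = Set.pi (Finset.range n) t' := by
  classical
  refine ⟨s.sup id + 1, fun k => if k ∈ s then t k else Set.univ, fun k => ?_, ?_⟩
  · dsimp only
    split_ifs
    exacts [ht k, .univ]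
  · ext ω
    simp only [Set.mem_pi, Finset.mem_coe, Finset.mem_range]
    constructor
    · intro h k _
      split_ifs with hk
      exacts [h k hk, trivial]
    · intro h k hk
      have := h k (Nat.lt_succ_of_le (Finset.le_sup (f := id) hk))
      rwa [if_pos hk] at this

variable [MeasurableSpace ι] [MeasurableSpace X]

theorem measurable_consSeq : Measurable fun z : ι × (ℕ → ι) => consSeq z.1 z.2 := by
  refine measurable_pi_iff.2 fun n => ?_
  cases n with
  | zero => exact measurable_fst
  | succ n => exact (measurable_pi_apply n).comp measurable_snd

section Stationary

variable [Fintype ι] {p : Measure ι} {f : ι → X → X} {m : Measure X}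

theorem lintegral_eq_sum_of_stationary (hf : ∀ i, Measurable (f i))
    (hstat : ∑ i, p {i} • m.map (f i) = m) {φ : X → ENNReal} (hφ : Measurable φ) :
    ∫⁻ x, φ x ∂m = ∑ i, p {i} * ∫⁻ x, φ (f i x) ∂m := by
  conv_lhs => rw [← hstat]
  rw [lintegral_finsetSum_measure]
  exact Finset.sum_congr rfl fun i _ => by
    rw [lintegral_smul_measure, lintegral_map hφ (hf i), smul_eq_mul]

theorem quasiMeasurePreserving_of_stationary (hf : ∀ i, Measurable (f i))
    (hp : ∀ i, p {i} ≠ 0) (hstat : ∑ i, p {i} • m.map (f i) = m) (i : ι) :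
    Measure.QuasiMeasurePreserving (f i) m m := by
  refine ⟨hf i, Measure.AbsolutelyContinuous.mk fun s hs h0 => ?_⟩
  rw [← hstat, Measure.finsetSum_apply, Finset.sum_eq_zero_iff] at h0
  simpa [hp i] using h0 i (Finset.mem_univ i)

end Stationary

variable (p : Measure ι) [IsProbabilityMeasure p]

theorem map_consSeq_infinitePi :
    (p.prod (Measure.infinitePi fun _ : ℕ => p)).map (fun z => consSeq z.1 z.2) =
      Measure.infinitePi fun _ : ℕ => p := by
  refine Measure.eq_infinitePi _ fun s t ht => ?_
  rw [← Measure.infinitePi_pi (μ := fun _ : ℕ => p) (fun i _ => ht i)]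
  obtain ⟨n, t', ht', hst⟩ := exists_pi_range_eq s t ht
  rw [hst, Measure.map_apply measurable_consSeq
    (.pi (Finset.countable_toSet _) fun k _ => ht' k)]
  cases n with
  | zero => simp
  | succ n =>
    have hpre : (fun z : ι × (ℕ → ι) => consSeq z.1 z.2) ⁻¹' Set.pi (Finset.range (n + 1)) t' =
        t' 0 ×ˢ Set.pi (Finset.range n) fun k => t' (k + 1) := by
      ext ⟨i, ω⟩
      by_cases hi : i ∈ t' 0
      · have := congrArg (ω ∈ ·) (consSeq_preimage_pi_range n t' i hi)
        simpa [hi] using this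
      · simp only [Set.mem_preimage, Set.mem_prod, hi, false_and, iff_false]
        exact fun h => hi (h 0 (by simp))
    rw [hpre, Measure.prod_prod, Measure.infinitePi_pi (μ := fun _ : ℕ => p) (fun k _ => ht' k),
      Measure.infinitePi_pi (μ := fun _ : ℕ => p) (fun k _ => ht' (k + 1)),
      Finset.prod_range_succ', mul_comm]

variable [Fintype ι] [MeasurableSingletonClass ι]

/-- Conditioning on the first symbol. -/
theorem infinitePi_apply_eq_sum {E : Set (ℕ → ι)} (hE : MeasurableSet E) :
    Measure.infinitePi (fun _ : ℕ => p) E =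
      ∑ i, p {i} * Measure.infinitePi (fun _ : ℕ => p) (consSeq i ⁻¹' E) := by
  conv_lhs => rw [← map_consSeq_infinitePi p]
  rw [Measure.map_apply measurable_consSeq hE, Measure.prod_apply (measurable_consSeq hE),
    lintegral_fintype]
  exact Finset.sum_congr rfl fun i _ => mul_comm _ _

/-- The skew product `(ω, x) ↦ (σ ω, f_{ω 0} x)` of a family of maps over the left shift. -/
def shiftSkew (f : ι → X → X) (z : (ℕ → ι) × X) : (ℕ → ι) × X :=
  (fun n => z.1 (n + 1), f (z.1 0) z.2)

theorem measurable_shiftSkew {f : ι → X → X} (hf : ∀ i, Measurable (f i)) :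
    Measurable (shiftSkew f) := by
  have hf' : Measurable fun z : ι × X => f z.1 z.2 := measurable_from_prod_countable_right hf
  have h0 : Measurable fun z : (ℕ → ι) × X => (z.1 0, z.2) :=
    ((measurable_pi_apply 0).comp measurable_fst).prodMk measurable_snd
  refine .prodMk ?_ (hf'.comp h0)
  exact measurable_pi_iff.2 fun n => (measurable_pi_apply (n + 1)).comp measurable_fst

/-- The measure of the fibre of `E` over a point is averaged over the maps when `E` is pulled back
by the skew product. -/
theorem infinitePi_section_preimage_shiftSkew {f : ι → X → X} (hf : ∀ i, Measurable (f i))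
    {E : Set ((ℕ → ι) × X)} (hE : MeasurableSet E) (x : X) :
    Measure.infinitePi (fun _ : ℕ => p) ((·, x) ⁻¹' (shiftSkew f ⁻¹' E)) =
      ∑ i, p {i} * Measure.infinitePi (fun _ : ℕ => p) ((·, f i x) ⁻¹' E) := by
  rw [infinitePi_apply_eq_sum p (measurable_prodMk_right (measurable_shiftSkew hf hE))]
  rfl

variable {p} {f : ι → X → X} {m : Measure X}

/-- A stationary measure for the random maps gives an invariant measure for the skew product. -/
theorem measurePreserving_shiftSkew [SFinite m] (hf : ∀ i, Measurable (f i))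
    (hstat : ∑ i, p {i} • m.map (f i) = m) :
    MeasurePreserving (shiftSkew f) ((Measure.infinitePi fun _ : ℕ => p).prod m)
      ((Measure.infinitePi fun _ : ℕ => p).prod m) := by
  refine ⟨measurable_shiftSkew hf, Measure.ext fun E hE => ?_⟩
  rw [Measure.map_apply (measurable_shiftSkew hf) hE,
    Measure.prod_apply_symm (measurable_shiftSkew hf hE), Measure.prod_apply_symm hE]
  simp_rw [infinitePi_section_preimage_shiftSkew p hf hE]
  have hm := measurable_measure_prodMk_right (μ := Measure.infinitePi fun _ : ℕ => p) hE
  have hmi : ∀ i, Measurable fun x => Measure.infinitePi (fun _ : ℕ => p) ((·, f i x) ⁻¹' E) :=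
    fun i => hm.comp (hf i)
  rw [lintegral_eq_sum_of_stationary hf hstat hm,
    lintegral_finsetSum _ fun i _ => (hmi i).const_mul _]
  exact Finset.sum_congr rfl fun i _ => lintegral_const_mul _ (hmi i)

/-- A bounded harmonic function is almost everywhere invariant under each of the maps: by
stationarity `∑ p_i ∫ (h ∘ f_i - h)² = ∫ h² - 2 ∫ h² + ∫ h² = 0`. -/
theorem ae_comp_eq_of_harmonic [IsProbabilityMeasure m] (hf : ∀ i, Measurable (f i))
    (hp : ∀ i, p {i} ≠ 0) (hstat : ∑ i, p {i} • m.map (f i) = m) {h : X → ℝ}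
    (hm : Measurable h) {C : ℝ} (hC : ∀ x, |h x| ≤ C)
    (hharm : ∀ x, ∑ i, p.real {i} * h (f i x) = h x) (i : ι) :
    h ∘ f i =ᵐ[m] h := by
  have hsum : ∑ i, p.real {i} = 1 := by simp
  have hsq : ∀ k : X → X, Measurable k → Integrable (fun x => h (k x) ^ 2) m := fun k hk =>
    .of_bound ((hm.comp hk).pow_const 2).aestronglyMeasurable (C ^ 2)
      (Eventually.of_forall fun x => by
        rw [Real.norm_eq_abs, abs_pow]
        exact pow_le_pow_left₀ (abs_nonneg _) (hC _) 2)
  have hpoint : ∀ x, ∑ i, p.real {i} * (h (f i x) - h x) ^ 2 =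
      ∑ i, p.real {i} * h (f i x) ^ 2 - h x ^ 2 := fun x => by
    calc ∑ i, p.real {i} * (h (f i x) - h x) ^ 2
        = ∑ i, (p.real {i} * h (f i x) ^ 2 - 2 * h x * (p.real {i} * h (f i x))
            + h x ^ 2 * p.real {i}) := Finset.sum_congr rfl fun i _ => by ring
      _ = _ := by
        rw [Finset.sum_add_distrib, Finset.sum_sub_distrib, ← Finset.mul_sum, ← Finset.mul_sum,
          hharm, hsum]
        ring
  have hstat' : ∫ x, h x ^ 2 ∂m = ∑ i, p.real {i} * ∫ x, h (f i x) ^ 2 ∂m := by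
    have hint : ∀ i ∈ Finset.univ, Integrable (fun x => h x ^ 2) (p {i} • m.map (f i)) :=
      fun i _ => ((integrable_map_measure (hm.pow_const 2).aestronglyMeasurable
        (hf i).aemeasurable).2 (hsq (f i) (hf i))).smul_measure (measure_ne_top _ _)
    conv_lhs => rw [← hstat]
    rw [integral_finsetSum_measure hint]
    exact Finset.sum_congr rfl fun i _ => by
      rw [integral_smul_measure, integral_map (hf i).aemeasurable
        (hm.pow_const 2).aestronglyMeasurable, smul_eq_mul, Measure.real]
  have hi2 : Integrable (fun x => h x ^ 2) m := hsq id measurable_id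
  have hi1 : Integrable (fun x => ∑ i, p.real {i} * h (f i x) ^ 2) m :=
    integrable_finsetSum _ fun i _ => (hsq (f i) (hf i)).const_mul _
  have hzero : ∫ x, ∑ i, p.real {i} * (h (f i x) - h x) ^ 2 ∂m = 0 := by
    simp_rw [hpoint]
    rw [integral_sub hi1 hi2, integral_finsetSum _ fun i _ => (hsq (f i) (hf i)).const_mul _,
      hstat']
    simp_rw [integral_const_mul, sub_self]
  have hnn : ∀ x i, 0 ≤ p.real {i} * (h (f i x) - h x) ^ 2 := fun x i =>
    mul_nonneg measureReal_nonneg (sq_nonneg _)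
  rw [integral_eq_zero_iff_of_nonneg (fun x => Finset.sum_nonneg fun i _ => hnn x i)
    (by simp_rw [hpoint]; exact hi1.sub hi2)] at hzero
  filter_upwards [hzero] with x hx
  have := (Finset.sum_eq_zero_iff_of_nonneg fun i _ => hnn x i).1 hx i (Finset.mem_univ i)
  have hpi : p.real {i} ≠ 0 := (measureReal_ne_zero_iff).2 (hp i)
  exact sub_eq_zero.1 (pow_eq_zero_iff two_ne_zero |>.1 ((mul_eq_zero.1 this).resolve_left hpi))

/-- If one of the maps is ergodic for a stationary measure `m`, then the skew product is ergodic.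
For an invariant set `A` the function `x ↦ ν (A_x)` is harmonic, hence invariant under the ergodic
map and so equal to a constant `c` almost everywhere. Conditioning on the first symbols,
`ν (A_x ∩ C) = c ν(C)` for every cylinder `C` and almost every `x`, so that `A` is independent of
every measurable set, in particular of itself. -/
theorem ergodic_shiftSkew [IsProbabilityMeasure m] (hf : ∀ i, Measurable (f i))
    (hp : ∀ i, p {i} ≠ 0) (hstat : ∑ i, p {i} • m.map (f i) = m) {i₀ : ι}
    (hi₀ : Ergodic (f i₀) m) :
    Ergodic (shiftSkew f) ((Measure.infinitePi fun _ : ℕ => p).prod m) := by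
  set ν : Measure (ℕ → ι) := Measure.infinitePi fun _ : ℕ => p with hν
  refine ⟨measurePreserving_shiftSkew hf hstat, ⟨fun A hA hAinv => ?_⟩⟩
  have hmeas : Measurable fun x => ν ((·, x) ⁻¹' A) := measurable_measure_prodMk_right hA
  have hharm : ∀ x, ν ((·, x) ⁻¹' A) = ∑ i, p {i} * ν ((·, f i x) ⁻¹' A) := fun x => by
    rw [hν, ← infinitePi_section_preimage_shiftSkew p hf hA, hAinv]
  obtain ⟨c', hc'⟩ : ∃ c' : ℝ, (fun x => ν.real ((·, x) ⁻¹' A)) =ᵐ[m] Function.const X c' := by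
    have hm : Measurable fun x => ν.real ((·, x) ⁻¹' A) := hmeas.ennreal_toReal
    refine hi₀.ae_eq_const_of_ae_eq_comp₀ hm.nullMeasurable
      (ae_comp_eq_of_harmonic hf hp hstat hm (C := 1) (fun x => ?_) (fun x => ?_) i₀)
    · rw [abs_of_nonneg measureReal_nonneg]
      exact measureReal_le_one
    · simp only [Measure.real]
      rw [hharm x, ENNReal.toReal_sum fun i _ => by finiteness]
      simp_rw [ENNReal.toReal_mul]
  set c : ENNReal := ENNReal.ofReal c'
  have hc : ∀ᵐ x ∂m, ν ((·, x) ⁻¹' A) = c := by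
    filter_upwards [hc'] with x hx
    rw [← ENNReal.ofReal_toReal (measure_ne_top ν ((·, x) ⁻¹' A))]
    exact congrArg ENNReal.ofReal hx
  have hcyl : ∀ (n : ℕ) (t : ℕ → Set ι), (∀ k, MeasurableSet (t k)) →
      ∀ᵐ x ∂m, ν ((·, x) ⁻¹' A ∩ Set.pi (Finset.range n) t) =
        c * ν (Set.pi (Finset.range n) t) := by
    intro n
    induction n with
    | zero => intro t _; simpa using hc
    | succ n ih =>
      intro t ht
      have hpull : ∀ᵐ x ∂m, ∀ i, ν ((·, f i x) ⁻¹' A ∩ Set.pi (Finset.range n) fun k => t (k + 1)) =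
          c * ν (Set.pi (Finset.range n) fun k => t (k + 1)) :=
        ae_all_iff.2 fun i => (quasiMeasurePreserving_of_stationary hf hp hstat i).ae
          (ih _ fun k => ht (k + 1))
      have htm : MeasurableSet (Set.pi (Finset.range (n + 1)) t : Set (ℕ → ι)) :=
        .pi (Finset.countable_toSet _) fun k _ => ht k
      filter_upwards [hpull] with x hx
      rw [hν, infinitePi_apply_eq_sum p ((measurable_prodMk_right hA).inter htm),
        infinitePi_apply_eq_sum p htm, Finset.mul_sum]
      refine Finset.sum_congr rfl fun i _ => ?_
      rw [Set.preimage_inter, mul_left_comm]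
      by_cases hi : i ∈ t 0
      · have hsec : consSeq i ⁻¹' ((·, x) ⁻¹' A) = (·, f i x) ⁻¹' A := by
          conv_lhs => rw [← hAinv]
          rfl
        rw [consSeq_preimage_pi_range n t i hi, hsec, ← hν, hx i]
      · have hemp : consSeq i ⁻¹' Set.pi (Finset.range (n + 1)) t = ∅ :=
          Set.eq_empty_of_forall_notMem fun ω h => hi (h 0 (by simp))
        rw [hemp]
        simp
  -- Equality on cylinders times measurable sets, which form a generating `π`-system, suffices.
  have hind : (c • ν).prod m = (ν.prod m).restrict A := by
    have : IsFiniteMeasure (c • ν) := Measure.smul_finite ν ENNReal.ofReal_ne_top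
    refine Measure.prod_eq_generateFrom generateFrom_squareCylinders
      MeasurableSpace.generateFrom_measurableSet
      (isPiSystem_squareCylinders (fun _ => MeasurableSpace.isPiSystem_measurableSet)
        fun _ => .univ)
      MeasurableSpace.isPiSystem_measurableSet
      ⟨fun _ => Set.univ, fun _ => ⟨∅, fun _ => Set.univ, fun _ _ => .univ, by simp⟩,
        fun _ => measure_lt_top _ _, Set.iUnion_const _⟩
      m.toFiniteSpanningSetsIn ?_
    rintro _ ⟨s, t, ht, rfl⟩ B hB
    obtain ⟨n, t', ht', hst⟩ := exists_pi_range_eq s t fun k => ht k trivial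
    rw [hst]
    have htm : MeasurableSet (Set.pi (Finset.range n) t' : Set (ℕ → ι)) :=
      .pi (Finset.countable_toSet _) fun k _ => ht' k
    rw [Measure.restrict_apply (htm.prod hB), Measure.prod_apply_symm ((htm.prod hB).inter hA),
      Measure.smul_apply, smul_eq_mul, ← setLIntegral_const, ← lintegral_indicator hB]
    refine lintegral_congr_ae ?_
    filter_upwards [hcyl n t' ht'] with x hx
    by_cases hxB : x ∈ B
    · rw [Set.indicator_of_mem hxB, ← hx]
      congr 1
      ext ω
      simp [hxB, and_comm]
    · rw [Set.indicator_of_notMem hxB]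
      have : (·, x) ⁻¹' (Set.pi (Finset.range n) t' ×ˢ B ∩ A) = (∅ : Set (ℕ → ι)) := by
        ext ω
        simp [hxB]
      rw [this, measure_empty]
  have hcompl : c * (ν.prod m) Aᶜ = 0 := by
    have := congrArg (fun κ : Measure _ => κ Aᶜ) hind
    simpa [Measure.prod_smul_left, Measure.restrict_apply hA.compl] using this
  have huniv : c = (ν.prod m) A := by
    have := congrArg (fun κ : Measure _ => κ Set.univ) hind
    simpa [Measure.prod_smul_left] using this
  rw [eventuallyConst_set]
  rcases mul_eq_zero.1 hcompl with h0 | h0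
  · exact .inr (measure_eq_zero_iff_ae_notMem.1 (huniv.symm.trans h0))
  · exact .inl (mem_ae_iff.2 h0)

end RandomMaps

/-! ### The maps of the unit interval -/

theorem measurableEmbedding_unitIco_val : MeasurableEmbedding (Subtype.val : UnitIco → ℝ) :=
  .subtype_coe measurableSet_Ico

theorem lebesgueIco_apply (B : Set UnitIco) : lebesgueIco B = volume (Subtype.val '' B : Set ℝ) :=
  measurableEmbedding_unitIco_val.comap_apply _ _

instance isProbabilityMeasure_lebesgueIco : IsProbabilityMeasure lebesgueIco :=
  ⟨by rw [lebesgueIco_apply, Set.image_univ, Subtype.range_coe, Real.volume_Ico]; simp⟩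

theorem measurable_fiberMap (M N : ℕ) (i : Fin (M + 1)) : Measurable (fiberMap M N i) := by
  unfold fiberMap
  split_ifs
  · exact (measurable_fract.comp (measurable_subtype_coe.const_mul _)).subtype_mk
  · exact (((measurable_subtype_coe.add_const _).sub_const _).div_const _).subtype_mk

/-- The quotient map from `[0,1)` onto the circle `ℝ ⧸ ℤ`, as a measurable equivalence. -/
noncomputable def unitIcoEquivCircle : UnitIco ≃ᵐ AddCircle (1 : ℝ) where
  toFun x := ((x : ℝ) : AddCircle (1 : ℝ))
  invFun y := ⟨(AddCircle.equivIco 1 0 y : ℝ), (AddCircle.equivIco (1 : ℝ) 0 y).2.1,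
    (AddCircle.equivIco (1 : ℝ) 0 y).2.2.trans_eq (zero_add 1)⟩
  left_inv x := Subtype.ext <|
    AddCircle.equivIco_coe_of_mem (p := (1 : ℝ)) (a := 0) ⟨x.2.1, x.2.2.trans_eq (zero_add 1).symm⟩
  right_inv _ := AddCircle.coe_equivIco (p := (1 : ℝ)) (a := 0)
  measurable_toFun := AddCircle.measurable_mk'.comp measurable_subtype_coe
  measurable_invFun :=
    (measurable_subtype_coe.comp (AddCircle.measurableEquivIco (1 : ℝ) 0).measurable).subtype_mk

theorem map_val_lebesgueIco :
    lebesgueIco.map Subtype.val = (volume : Measure ℝ).restrict (Set.Ioc 0 (0 + 1)) := by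
  rw [lebesgueIco, measurableEmbedding_unitIco_val.map_comap, Subtype.range_coe, zero_add]
  exact restrict_Ico_eq_restrict_Ioc

theorem measurePreserving_unitIcoEquivCircle :
    MeasurePreserving unitIcoEquivCircle lebesgueIco volume := by
  refine ⟨unitIcoEquivCircle.measurable, ?_⟩
  rw [← (AddCircle.measurePreserving_mk 1 0).map_eq, ← map_val_lebesgueIco,
    Measure.map_map AddCircle.measurable_mk' measurable_subtype_coe]
  rfl

/-- The map `x ↦ N x (mod 1)` is conjugate to multiplication by `N` on the circle. -/
theorem ergodic_fiberMap_zero (M : ℕ) {N : ℕ} (hN : 2 ≤ N) :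
    Ergodic (fiberMap M N 0) lebesgueIco := by
  rw [← measurePreserving_unitIcoEquivCircle.ergodic_conjugate_iff]
  convert AddCircle.ergodic_nsmul (T := (1 : ℝ)) (show 1 < N by omega) using 1
  funext y
  obtain ⟨x, rfl⟩ := unitIcoEquivCircle.surjective y
  simp only [Function.comp_apply, MeasurableEquiv.symm_apply_apply]
  change ((Int.fract ((N : ℝ) * x) : ℝ) : AddCircle (1 : ℝ)) = N • ((x : ℝ) : AddCircle (1 : ℝ))
  rw [← AddCircle.coe_nsmul, nsmul_eq_mul, ← sub_eq_zero, ← AddCircle.coe_sub,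
    AddCircle.coe_eq_zero_iff]
  exact ⟨-⌊(N : ℝ) * x⌋, by
    rw [← Int.self_sub_floor, zsmul_one]
    push_cast
    ring⟩

theorem lebesgueIco_preimage_fiberMap_succ {M : ℕ} (hM : 0 < M) (N : ℕ) (j : Fin M)
    (B : Set UnitIco) :
    lebesgueIco (fiberMap M N j.succ ⁻¹' B) =
      M * volume ((Subtype.val '' B : Set ℝ) ∩ Set.Ico ((j : ℝ) / M) ((j + 1 : ℝ) / M)) := by
  have hM' : (0 : ℝ) < M := by exact_mod_cast hM
  have himg : (Subtype.val '' (fiberMap M N j.succ ⁻¹' B) : Set ℝ) =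
      (fun x => (M : ℝ)⁻¹ * x) ⁻¹' ((fun x => (j : ℝ) / M + x) ⁻¹'
        ((Subtype.val '' B : Set ℝ) ∩ Set.Ico ((j : ℝ) / M) ((j + 1 : ℝ) / M))) := by
    have hval : ∀ x : UnitIco, (fiberMap M N j.succ x : ℝ) = (j : ℝ) / M + (M : ℝ)⁻¹ * x := by
      intro x
      simp only [fiberMap, Fin.succ_ne_zero, dite_false, Fin.val_succ]
      push_cast
      field_simp
      ring
    ext y
    simp only [Set.mem_preimage, Set.mem_inter_iff, Set.mem_Ico, Set.mem_image]
    have hy : ((j : ℝ) / M ≤ (j : ℝ) / M + (M : ℝ)⁻¹ * y ∧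
        (j : ℝ) / M + (M : ℝ)⁻¹ * y < (j + 1 : ℝ) / M) ↔ y ∈ Set.Ico (0 : ℝ) 1 := by
      rw [show (j : ℝ) / M + (M : ℝ)⁻¹ * y = (j + y) / M by field_simp,
        div_le_div_iff_of_pos_right hM', div_lt_div_iff_of_pos_right hM']
      simp
    rw [hy]
    constructor
    · rintro ⟨x, hx, rfl⟩
      exact ⟨⟨_, hx, hval x⟩, x.2⟩
    · rintro ⟨⟨b, hb, hby⟩, hy1⟩
      refine ⟨⟨y, hy1⟩, ?_, rfl⟩
      rwa [show fiberMap M N j.succ ⟨y, hy1⟩ = b from Subtype.ext ((hval _).trans hby.symm)]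
  rw [lebesgueIco_apply, himg, Real.volume_preimage_mul_left (inv_ne_zero hM'.ne'),
    measure_preimage_add, inv_inv, abs_of_pos hM', ENNReal.ofReal_natCast]

/-- The intervals `[j/M, (j+1)/M)`, the images of the contractions, tile `[0,1)`. -/
theorem sum_lebesgueIco_preimage_fiberMap_succ {M : ℕ} (hM : 0 < M) (N : ℕ) {B : Set UnitIco}
    (hB : MeasurableSet B) :
    ∑ j : Fin M, lebesgueIco (fiberMap M N j.succ ⁻¹' B) = M * lebesgueIco B := by
  have hM' : (0 : ℝ) < M := by exact_mod_cast hM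
  simp_rw [lebesgueIco_preimage_fiberMap_succ hM]
  rw [← Finset.mul_sum, lebesgueIco_apply]
  congr 1
  have hmem : ∀ (x : ℝ) (j : ℕ), x ∈ Set.Ico ((j : ℝ) / M) ((j + 1 : ℝ) / M) ↔
      (j : ℝ) ≤ x * M ∧ x * M < j + 1 := fun x j => by
    rw [Set.mem_Ico, div_le_iff₀ hM', lt_div_iff₀ hM']
  rw [← measure_biUnion_finset]
  · congr 1
    ext x
    simp only [Set.mem_iUnion, Set.mem_inter_iff, Finset.mem_univ, exists_const, hmem]
    constructor
    · rintro ⟨_, h, _⟩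
      exact h
    · rintro ⟨b, hb, rfl⟩
      have h0 : 0 ≤ (b : ℝ) * M := mul_nonneg b.2.1 hM'.le
      refine ⟨⟨⌊(b : ℝ) * M⌋₊, (Nat.floor_lt h0).2 ?_⟩, ⟨b, hb, rfl⟩, Nat.floor_le h0,
        Nat.lt_floor_add_one _⟩
      nlinarith [b.2.2]
  · intro i _ j _ hij
    refine Set.disjoint_left.2 fun x hxi hxj => hij (Fin.ext ?_)
    have h1 := (hmem x i).1 hxi.2
    have h2 := (hmem x j).1 hxj.2
    have h3 : (i : ℕ) < j + 1 := by exact_mod_cast h1.1.trans_lt h2.2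
    have h4 : (j : ℕ) < i + 1 := by exact_mod_cast h2.1.trans_lt h1.2
    omega
  · exact fun j _ => (measurableEmbedding_unitIco_val.measurableSet_image.2 hB).inter
      measurableSet_Ico

theorem symbolPMF_toMeasure_singleton (M : ℕ) (hM : 2 ≤ M) (p₀ : ℝ) (h₀ : 0 < p₀) (h₁ : p₀ < 1)
    (i : Fin (M + 1)) :
    (symbolPMF M hM p₀ h₀ h₁).toMeasure {i} = ENNReal.ofReal (probVec M p₀ i) := by
  rw [PMF.toMeasure_apply_singleton _ _ (measurableSet_singleton i)]
  rfl

theorem stationary_lebesgueIco (M N : ℕ) (hM : 2 ≤ M) (hN : 2 ≤ N) (p₀ : ℝ) (h₀ : 0 < p₀)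
    (h₁ : p₀ < 1) :
    ∑ i, (symbolPMF M hM p₀ h₀ h₁).toMeasure {i} • lebesgueIco.map (fiberMap M N i) =
      lebesgueIco := by
  have hM' : (M : ℝ) ≠ 0 := by
    have : M ≠ 0 := by omega
    exact_mod_cast this
  refine Measure.ext fun B hB => ?_
  rw [Fin.sum_univ_succ, (ergodic_fiberMap_zero M hN).toMeasurePreserving.map_eq]
  simp only [symbolPMF_toMeasure_singleton, probVec, Fin.succ_ne_zero, if_true, if_false,
    Measure.add_apply, Measure.smul_apply, Measure.finsetSum_apply, smul_eq_mul,
    Measure.map_apply (measurable_fiberMap M N _) hB]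
  rw [← Finset.mul_sum, sum_lebesgueIco_preimage_fiberMap_succ (by omega) N hB, ← mul_assoc,
    ← add_mul, ← ENNReal.ofReal_natCast, ← ENNReal.ofReal_mul (div_nonneg (by linarith)
    (Nat.cast_nonneg M)), div_mul_cancel₀ _ hM', ← ENNReal.ofReal_add h₀.le (by linarith)]
  simp

/-! ### Ergodicity and equidistribution -/

theorem ergodic_skewProduct (M N : ℕ) (hM : 2 ≤ M) (hN : 2 ≤ N) (p₀ : ℝ) (h₀ : 0 < p₀)
    (h₁ : p₀ < 1) : Ergodic (skewProduct M N) (skewMeasure M hM p₀ h₀ h₁) := by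
  refine ergodic_shiftSkew (measurable_fiberMap M N) (fun i => ?_)
    (stationary_lebesgueIco M N hM hN p₀ h₀ h₁) (ergodic_fiberMap_zero M hN)
  have hM' : (0 : ℝ) < M := by
    have : 0 < M := by omega
    exact_mod_cast this
  rw [symbolPMF_toMeasure_singleton, ne_eq, ENNReal.ofReal_eq_zero, not_le, probVec]
  split_ifs
  · exact h₀
  · exact div_pos (by linarith) hM'

theorem iterate_skewProduct (M N : ℕ) (z : (ℕ → Fin (M + 1)) × UnitIco) (n : ℕ) :
    (skewProduct M N)^[n] z = (fun k => z.1 (k + n), randomOrbit M N z.1 n z.2) := by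
  induction n with
  | zero => rfl
  | succ n ih =>
    rw [Function.iterate_succ_apply', ih]
    simp only [skewProduct, randomOrbit, zero_add, Prod.mk.injEq, and_true]
    funext k
    exact congrArg z.1 (by omega)

theorem typicalOrbitsUniform_of_ergodic (M N : ℕ) (hM : 2 ≤ M) (p₀ : ℝ) (h₀ : 0 < p₀)
    (h₁ : p₀ < 1) (herg : Ergodic (skewProduct M N) (skewMeasure M hM p₀ h₀ h₁)) :
    TypicalOrbitsUniform M N hM p₀ h₀ h₁ := by
  intro A hA
  have : IsProbabilityMeasure (bernoulliSeq M hM p₀ h₀ h₁) := by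
    unfold bernoulliSeq
    infer_instance
  have : IsProbabilityMeasure (skewMeasure M hM p₀ h₀ h₁) := by
    unfold skewMeasure
    infer_instance
  set g : (ℕ → Fin (M + 1)) × UnitIco → ℝ := (Prod.snd ⁻¹' A).indicator fun _ => 1 with hg
  have hA' : MeasurableSet (Prod.snd ⁻¹' A : Set ((ℕ → Fin (M + 1)) × UnitIco)) :=
    measurable_snd hA
  have hint : ∫ z, g z ∂(skewMeasure M hM p₀ h₀ h₁) = (lebesgueIco A).toReal := by
    rw [hg, integral_indicator_const _ hA', smul_eq_mul, mul_one, Measure.real, skewMeasure,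
      ← Set.univ_prod, Measure.prod_prod, measure_univ, one_mul]
  have hgm : Measurable g := measurable_const.indicator hA'
  filter_upwards [herg.ae_tendsto_birkhoffAverage hgm ((integrable_const (1 : ℝ)).indicator hA')]
    with z hz
  rw [hint] at hz
  refine hz.congr fun n => ?_
  rw [birkhoffAverage, birkhoffSum, smul_eq_mul, one_div]
  congr 1
  refine Finset.sum_congr rfl fun i _ => ?_
  rw [iterate_skewProduct]
  rfl

theorem theoremt (M N : ℕ) (hM : 2 ≤ M) (hN : 2 ≤ N) (p₀ : ℝ) (h₀ : 0 < p₀) (h₁ : p₀ < 1) :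
    (lyapunovExp M N p₀ < 0 →
      Ergodic (skewProduct M N) (skewMeasure M hM p₀ h₀ h₁) ∧
        TypicalOrbitsUniform M N hM p₀ h₀ h₁) ∧
    (lyapunovExp M N p₀ = 0 →
      Ergodic (skewProduct M N) (skewMeasure M hM p₀ h₀ h₁) ∧
        TypicalOrbitsUniform M N hM p₀ h₀ h₁) ∧
    (0 < lyapunovExp M N p₀ →
      Ergodic (skewProduct M N) (skewMeasure M hM p₀ h₀ h₁) ∧
        TypicalOrbitsUniform M N hM p₀ h₀ h₁) := by
  have herg := ergodic_skewProduct M N hM hN p₀ h₀ h₁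
  have huni := typicalOrbitsUniform_of_ergodic M N hM p₀ h₀ h₁ herg
  exact ⟨fun _ => ⟨herg, huni⟩, fun _ => ⟨herg, huni⟩, fun _ => ⟨herg, huni⟩⟩
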